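/- A digraph $D$ is a set of vertices with a set of ordered pairs of vertices (edges); all digraphs are infinite, connected (as undirected graphs) and without loops. For $s\ge 0$ an $s$-arc from $u$ to $v$ is a sequence of vertices $u=u_0,u_1,\dots,u_s=v$ with each $(u_i,u_{i+1})$ an edge and $u_{i-1}\ne u_{i+1}$ for $0<i<s$. Let $D^s(u)$ be the set of vertices reachable from $u$ by an $s$-arc, let $\mathrm{desc}(u)=\bigcup_{s\ge 0}D^s(u)$, and for a set $X$ of vertices let $\mathrm{desc}(X)=\bigcup_{x\in X}\mathrm{desc}(x)$, regarded as a full induced subdigraph. $D$ is distance-transitive if for every $s\ge 0$ the group $\mathrm{Aut}(D)$ is transitive on the pairs $(u,v)$ for which there is an $s$-arc from $u$ to $v$ but no $t$-arc with $t<s$. $D$ is weakly descendant-homogeneous if it is vertex transitive and for all finite sets $X,Y$ of vertices and every digraph isomorphism $f:\mathrm{desc}(X)\to\mathrm{desc}(Y)$ there is an automorphism of $D$ agreeing with $f$ on $X$. For $n\ge 1$ let $\delta_n$ be the equivalence relation on vertices given by $\delta_n(u,v)\iff D^n(u)=D^n(v)$; it is non-trivial if it relates two distinct vertices. $D$ is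 imprimitive if there is a proper subset $B$ of its vertex set, with at least two elements, such that each $g\in\mathrm{Aut}(D)$ satisfies $B^g=B$ or $B\cap B^g=\varnothing$. Let $Z$ be the digraph with vertex set $\mathbb{Z}$ and edges $(i,i+1)$, $i\in\mathbb{Z}$. Theorem. Let $D$ be an infinite, connected, distance-transitive, weakly descendant-homogeneous digraph of finite out-valency $m>0$ with no directed cycles. If $D$ is not isomorphic to $Z$, then there is $n\ge 1$ such that $\delta_n$ is non-trivial. In all cases (including $D\cong Z$), $D$ is imprimitive. -/

import Mathlib

namespace Digraph

variable {V W : Type*}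

/-- Isomorphisms of digraphs: bijections of the vertex sets preserving and reflecting edges. -/
abbrev Iso (D : Digraph V) (D' : Digraph W) : Type _ := D.Adj ≃r D'.Adj

/-- The automorphism group of a digraph, acting on its vertices. -/
abbrev Aut (D : Digraph V) : Type _ := D.Adj ≃r D.Adj

/-- The full induced subdigraph on a set of vertices. -/
def inducedOn (D : Digraph V) (S : Set V) : Digraph S where
  Adj a b := D.Adj a b

/-- There is an `s`-arc (a directed path of length `s`) from `u` to `v`: vertices
`p 0 = u, p 1, …, p s = v` with an edge from each to the next and `p (i - 1) ≠ p (i + 1)`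
for `0 < i < s`. The values of `p` beyond `s` play no role. -/
def HasArc (D : Digraph V) (s : ℕ) (u v : V) : Prop :=
  ∃ p : ℕ → V, p 0 = u ∧ p s = v ∧ (∀ i, i < s → D.Adj (p i) (p (i + 1))) ∧
    ∀ i, 0 < i → i < s → p (i - 1) ≠ p (i + 1)

/-- `D^s(u)`: the vertices reachable from `u` by an `s`-arc. -/
def descLayer (D : Digraph V) (s : ℕ) (u : V) : Set V :=
  {v | D.HasArc s u v}

/-- The descendant set of a set `X` of vertices: all vertices reachable from a vertex of `X` by
an `s`-arc for some `s ≥ 0`. -/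
def desc (D : Digraph V) (X : Set V) : Set V :=
  {v | ∃ x ∈ X, ∃ s : ℕ, v ∈ D.descLayer s x}

/-- The shortest arc from `u` to `v` has length `s`. -/
def HasDist (D : Digraph V) (s : ℕ) (u v : V) : Prop :=
  D.HasArc s u v ∧ ∀ t, t < s → ¬ D.HasArc t u v

/-- Distance-transitivity: for each `s ≥ 0` the automorphism group is transitive on the pairs
`(u, v)` for which there is an `s`-arc from `u` to `v` but no shorter arc. -/
def DistanceTransitive (D : Digraph V) : Prop :=
  ∀ (s : ℕ) (u v u' v' : V), D.HasDist s u v → D.HasDist s u' v' →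
    ∃ g : D.Aut, g u = u' ∧ g v = v'

def VertexTransitive (D : Digraph V) : Prop :=
  ∀ u v : V, ∃ g : D.Aut, g u = v

/-- Weak descendant-homogeneity: vertex transitivity, and for every isomorphism `f` between the
induced subdigraphs on the descendant sets of two finite sets `X` and `Y` there is an
automorphism of `D` which agrees with `f` on `X`. -/
def WeaklyDescendantHomogeneous (D : Digraph V) : Prop :=
  D.VertexTransitive ∧
    ∀ X Y : Set V, X.Finite → Y.Finite →
      ∀ f : (D.inducedOn (D.desc X)).Iso (D.inducedOn (D.desc Y)),
        ∃ g : D.Aut, ∀ x : D.desc X, (x : V) ∈ X → g x = f x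

/-- Every vertex has exactly `m` out-neighbours. -/
def HasOutValency (D : Digraph V) (m : ℕ) : Prop :=
  ∀ u : V, {v | D.Adj u v}.encard = m

/-- No closed directed walk of positive length; in particular no loops and no pair of
opposite edges. -/
def NoDirectedCycles (D : Digraph V) : Prop :=
  ∀ u : V, ¬ Relation.TransGen D.Adj u u

/-- The relation `δ_n`: the vertices `u` and `v` have the same `n`-th descendant layer. -/
def delta (D : Digraph V) (n : ℕ) (u v : V) : Prop :=
  D.descLayer n u = D.descLayer n v

/-- An (equivalence) relation is non-trivial if it relates two distinct vertices. -/
def NontrivialRel (r : V → V → Prop) : Prop :=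
  ∃ u v : V, u ≠ v ∧ r u v

/-- A digraph is imprimitive if its automorphism group has a block of imprimitivity: a block which
is a proper subset of the vertex set with at least two elements. -/
def Imprimitive (D : Digraph V) : Prop :=
  ∃ B : Set V, MulAction.IsBlock D.Aut B ∧ B.Nontrivial ∧ B ≠ Set.univ

/-- The two-way infinite directed path: the integers with the edges `(i, i + 1)`. -/
def intPath : Digraph ℤ where
  Adj i j := j = i + 1

end Digraph

namespace Digraph

open Relation

variable {V : Type*} {D : Digraph V} {u v w x y z : V} {k n s t m : ℕ} {X : Set V}

/-! ### Arcs -/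

/-! For out-valency `m > 1`, suppose every `δ_n` is trivial. Each layer `D^k(u)` is finite, so far
below `u` a vertex gains no further ancestors in it by passing to descendants
(`exists_layerAncestors_stable`). For large `n` the ancestors in `D^1(u)` are therefore constant on
the components of `desc (D^n(u))`. Homogeneity swaps two components and fixes the elements of
`D^n(u)` in all others; the swap preserves `D^n(u)`, so it fixes `u` because `δ_n` is trivial. Hence
distinct components have distinct ancestor sets in `D^1(u)` (`linked_of_layerAncestors_eq`). It
follows that deep vertices of one layer with equal ancestor sets coincide, yet two out-neighbours of
a deep vertex have equal ancestor sets.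

For `m = 1` the edges are the graph of a function, and triviality of `δ_1` makes it a permutation
with a single infinite orbit. Blocks are the `δ_n`-classes, or the even integers for `Z`. -/

/-- Reachability by a directed walk of a given length. -/
def Steps (D : Digraph V) : ℕ → V → V → Prop
  | 0, u, v => u = v
  | s + 1, u, v => ∃ w, D.Steps s u w ∧ D.Adj w v

theorem Steps.exists_walk (h : D.Steps s u v) :
    ∃ p : ℕ → V, p 0 = u ∧ p s = v ∧ ∀ i, i < s → D.Adj (p i) (p (i + 1)) := by
  induction s generalizing v with
  | zero => exact ⟨fun _ => u, rfl, h, fun i hi => absurd hi (Nat.not_lt_zero i)⟩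
  | succ s ih =>
    obtain ⟨w, hw, hwv⟩ := h
    obtain ⟨p, h0, hs, hp⟩ := ih hw
    refine ⟨fun i => if i ≤ s then p i else v, by simp [h0], by simp, fun i hi => ?_⟩
    rcases Nat.lt_succ_iff_lt_or_eq.1 hi with h | rfl
    · simpa [h.le, Nat.succ_le_of_lt h] using hp i h
    · simpa [hs] using hwv

theorem HasArc.steps (h : D.HasArc s u v) : D.Steps s u v := by
  obtain ⟨p, h0, hs, hp, -⟩ := h
  have : ∀ i, i ≤ s → D.Steps i u (p i) := by
    intro i
    induction i with
    | zero => exact fun _ => h0.symm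
    | succ i ih => exact fun hi => ⟨p i, ih (by omega), hp i (by omega)⟩
  exact hs ▸ this s le_rfl

/-- A backtracking step would close a directed 2-cycle, so the side condition on arcs is automatic.
-/
theorem Steps.hasArc (hc : D.NoDirectedCycles) (h : D.Steps s u v) : D.HasArc s u v := by
  obtain ⟨p, h0, hs, hp⟩ := h.exists_walk
  refine ⟨p, h0, hs, hp, fun i hi his heq => hc (p (i - 1)) ?_⟩
  have h₁ := hp (i - 1) (by omega)
  rw [Nat.sub_add_cancel hi] at h₁
  have h₂ := hp i his
  rw [← heq] at h₂
  exact .head h₁ (.single h₂)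

theorem hasArc_iff_steps (hc : D.NoDirectedCycles) : D.HasArc s u v ↔ D.Steps s u v :=
  ⟨HasArc.steps, Steps.hasArc hc⟩

theorem steps_add : D.Steps (s + t) u v ↔ ∃ w, D.Steps s u w ∧ D.Steps t w v := by
  induction t generalizing v with
  | zero => exact ⟨fun h => ⟨v, h, rfl⟩, fun ⟨w, h, e⟩ => e ▸ h⟩
  | succ t ih =>
    constructor
    · rintro ⟨w, hw, hwv⟩
      obtain ⟨x, hx, hxw⟩ := ih.1 hw
      exact ⟨x, hx, w, hxw, hwv⟩
    · rintro ⟨x, hx, w, hxw, hwv⟩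
      exact ⟨w, ih.2 ⟨x, hx, hxw⟩, hwv⟩

theorem hasArc_zero (hc : D.NoDirectedCycles) : D.HasArc 0 u v ↔ u = v := hasArc_iff_steps hc

theorem hasArc_one (hc : D.NoDirectedCycles) : D.HasArc 1 u v ↔ D.Adj u v := by
  rw [hasArc_iff_steps hc]
  exact ⟨fun ⟨w, e, h⟩ => (show u = w from e) ▸ h, fun h => ⟨u, rfl, h⟩⟩

theorem hasArc_add (hc : D.NoDirectedCycles) :
    D.HasArc (s + t) u v ↔ ∃ w, D.HasArc s u w ∧ D.HasArc t w v := by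
  simp only [hasArc_iff_steps hc, steps_add]

theorem hasArc_succ (hc : D.NoDirectedCycles) :
    D.HasArc (s + 1) u v ↔ ∃ w, D.HasArc s u w ∧ D.Adj w v := by
  simp only [hasArc_add hc, hasArc_one hc]

theorem HasArc.trans (hc : D.NoDirectedCycles) (h₁ : D.HasArc s u w) (h₂ : D.HasArc t w v) :
    D.HasArc (s + t) u v :=
  (hasArc_add hc).2 ⟨w, h₁, h₂⟩

theorem Steps.transGen (h : D.Steps s u v) (hs : 0 < s) : TransGen D.Adj u v := by
  induction s generalizing v with
  | zero => omega
  | succ s ih =>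
    obtain ⟨w, hw, hwv⟩ := h
    rcases Nat.eq_zero_or_pos s with rfl | h0
    · exact .single ((show u = w from hw) ▸ hwv)
    · exact .tail (ih hw h0) hwv

theorem HasArc.map (h : D.HasArc s u v) (g : D.Aut) : D.HasArc s (g u) (g v) := by
  obtain ⟨p, h0, hs, hp, hne⟩ := h
  exact ⟨fun i => g (p i), by simp [h0], by simp [hs], fun i hi => g.map_rel_iff.2 (hp i hi),
    fun i h₁ h₂ e => hne i h₁ h₂ (g.injective e)⟩

theorem hasArc_map_iff (g : D.Aut) : D.HasArc s (g u) (g v) ↔ D.HasArc s u v :=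
  ⟨fun h => by simpa using h.map g.symm, fun h => h.map g⟩

theorem descLayer_map (g : D.Aut) : D.descLayer s (g u) = g '' D.descLayer s u := by
  ext v
  constructor
  · intro h
    refine ⟨g.symm v, ?_, by simp⟩
    simpa [descLayer] using HasArc.map h g.symm
  · rintro ⟨w, hw, rfl⟩
    exact HasArc.map hw g

theorem HasOutValency.exists_adj (hm : 0 < m) (hout : D.HasOutValency m) (u : V) :
    ∃ v, D.Adj u v := by
  have h : {v | D.Adj u v}.encard ≠ 0 := by
    rw [hout u]; exact_mod_cast hm.ne'
  exact Set.encard_ne_zero.1 h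

theorem HasOutValency.exists_hasArc (hc : D.NoDirectedCycles) (hm : 0 < m)
    (hout : D.HasOutValency m) (s : ℕ) (u : V) : ∃ v, D.HasArc s u v := by
  induction s with
  | zero => exact ⟨u, (hasArc_zero hc).2 rfl⟩
  | succ s ih =>
    obtain ⟨w, hw⟩ := ih
    obtain ⟨v, hv⟩ := hout.exists_adj hm w
    exact ⟨v, (hasArc_succ hc).2 ⟨w, hw, hv⟩⟩

theorem HasOutValency.finite_descLayer (hc : D.NoDirectedCycles)
    (hout : D.HasOutValency m) (s : ℕ) (u : V) : (D.descLayer s u).Finite := by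
  induction s with
  | zero =>
    exact (Set.finite_singleton u).subset fun v hv => ((hasArc_zero hc).1 hv).symm
  | succ s ih =>
    refine (ih.biUnion (t := fun w => {v | D.Adj w v}) fun w _ => ?_).subset fun v hv => ?_
    · exact Set.finite_of_encard_eq_coe (hout w)
    · obtain ⟨w, hw, hwv⟩ := (hasArc_succ hc).1 hv
      exact Set.mem_biUnion (x := w) hw hwv

/-! ### Distances in descendant sets -/

/-- For the least bad `s`, distance-transitivity spreads the longer arc to every vertex of `D^s(u)`.
Cutting that arc after `s` steps puts a proper ancestor of each vertex into the same layer, which is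
impossible in a finite acyclic set. -/
theorem DistanceTransitive.not_hasArc_of_lt (hc : D.NoDirectedCycles) (hout : D.HasOutValency m)
    (hdist : D.DistanceTransitive) (hst : s < t) (hs : D.HasArc s u v) : ¬ D.HasArc t u v := by
  induction s using Nat.strong_induction_on generalizing t v with
  | _ s ih =>
    intro ht
    have hdist' : ∀ x, D.HasArc s u x → D.HasDist s u x :=
      fun x hx => ⟨hx, fun r hr hrx => ih r hr hr hrx hx⟩
    have key : ∀ x ∈ D.descLayer s u, ∃ y ∈ D.descLayer s u, TransGen D.Adj y x := by
      intro x hx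
      obtain ⟨g, hgu, hgv⟩ := hdist s u v u x (hdist' v hs) (hdist' x hx)
      have h := ht.map g
      rw [hgu, hgv, ← Nat.add_sub_cancel' hst.le, hasArc_add hc] at h
      obtain ⟨y, hy, hyx⟩ := h
      exact ⟨y, hy, hyx.steps.transGen (by omega)⟩
    have : IsStrictOrder V (TransGen D.Adj) :=
      { irrefl := hc, trans := fun _ _ _ => TransGen.trans }
    have hwf : (D.descLayer s u).WellFoundedOn (TransGen D.Adj) :=
      (hout.finite_descLayer hc s u).wellFoundedOn
    obtain ⟨⟨x, hx⟩, -, hmin⟩ := hwf.has_min Set.univ ⟨⟨v, hs⟩, trivial⟩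
    obtain ⟨y, hy, hyx⟩ := key x hx
    exact hmin ⟨y, hy⟩ trivial hyx

theorem DistanceTransitive.length_unique (hc : D.NoDirectedCycles) (hout : D.HasOutValency m)
    (hdist : D.DistanceTransitive) (hs : D.HasArc s u v) (ht : D.HasArc t u v) : s = t := by
  rcases lt_trichotomy s t with h | h | h
  · exact absurd ht (hdist.not_hasArc_of_lt hc hout h hs)
  · exact h
  · exact absurd hs (hdist.not_hasArc_of_lt hc hout h ht)

theorem DistanceTransitive.exists_aut_fixing (hc : D.NoDirectedCycles) (hout : D.HasOutValency m)
    (hdist : D.DistanceTransitive) (hv : D.HasArc s u v) (hw : D.HasArc s u w) :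
    ∃ g : D.Aut, g u = u ∧ g v = w :=
  hdist s u v u w ⟨hv, fun _ ht h => hdist.not_hasArc_of_lt hc hout ht h hv⟩
    ⟨hw, fun _ ht h => hdist.not_hasArc_of_lt hc hout ht h hw⟩

/-! ### Ancestors in a layer -/

/-- The vertices of the `k`-th descendant layer of `u` which have `x` as a descendant. -/
def layerAncestors (D : Digraph V) (u : V) (k : ℕ) (x : V) : Set V :=
  {v | D.HasArc k u v ∧ ∃ t, D.HasArc t v x}

theorem layerAncestors_subset : D.layerAncestors u k x ⊆ D.descLayer k u := fun _ h => h.1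

theorem layerAncestors_mono (hc : D.NoDirectedCycles) (h : D.HasArc t x y) :
    D.layerAncestors u k x ⊆ D.layerAncestors u k y :=
  fun _ ⟨hv, s, hs⟩ => ⟨hv, s + t, hs.trans hc h⟩

theorem layerAncestors_map (g : D.Aut) (hg : g u = u) :
    D.layerAncestors u k (g x) = g '' D.layerAncestors u k x := by
  ext v
  constructor
  · rintro ⟨hv, t, ht⟩
    refine ⟨g.symm v, ⟨?_, t, ?_⟩, by simp⟩
    · rw [← hasArc_map_iff g]; simpa [hg] using hv
    · rw [← hasArc_map_iff g]; simpa using ht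
  · rintro ⟨w, ⟨hw, t, ht⟩, rfl⟩
    exact ⟨by simpa [hg] using hw.map g, t, ht.map g⟩

theorem hasArc_of_mem_layerAncestors (hc : D.NoDirectedCycles) (hout : D.HasOutValency m)
    (hdist : D.DistanceTransitive) (hx : D.HasArc (k + n) u x)
    (hv : v ∈ D.layerAncestors u k x) : D.HasArc n v x := by
  obtain ⟨hv, t, ht⟩ := hv
  have := hdist.length_unique hc hout hx (hv.trans hc ht)
  obtain rfl : n = t := by omega
  exact ht

/-- Far enough below `u`, passing to a descendant yields no new ancestors in the layer `k`. -/
theorem exists_layerAncestors_stable (hc : D.NoDirectedCycles) (hout : D.HasOutValency m)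
    (hdist : D.DistanceTransitive) (u : V) (k : ℕ) :
    ∃ N, ∀ n, N ≤ n → ∀ x, D.HasArc n u x → ∀ t y, D.HasArc t x y →
      D.layerAncestors u k y = D.layerAncestors u k x := by
  have hfin : ∀ x, (D.layerAncestors u k x).Finite :=
    fun x => (hout.finite_descLayer hc k u).subset layerAncestors_subset
  -- The sizes of the ancestor sets are bounded by that of the layer; take a vertex `x₀`, at depth
  -- `N`, with the largest set.
  let C : Set ℕ := {c | ∃ n x, D.HasArc n u x ∧ (D.layerAncestors u k x).ncard = c}
  have hne : C.Nonempty := ⟨_, 0, u, (hasArc_zero hc).2 rfl, rfl⟩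
  have hbdd : BddAbove C := by
    refine ⟨(D.descLayer k u).ncard, ?_⟩
    rintro _ ⟨n, x, -, rfl⟩
    exact Set.ncard_le_ncard layerAncestors_subset (hout.finite_descLayer hc k u)
  obtain ⟨N, x₀, hx₀, hmax⟩ := Nat.sSup_mem hne hbdd
  refine ⟨N, fun n hn x hx t y hxy => ?_⟩
  have hxy' := hx.trans hc hxy
  rw [← Nat.add_sub_cancel' hn] at hx
  -- The stabilizer of `u` is transitive on depth `N`, so the ancestor `x'` of `x` at that depth
  -- already has a set of maximal size.
  obtain ⟨x', hx', hx'x⟩ := (hasArc_add hc).1 hx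
  obtain ⟨g, hgu, rfl⟩ := hdist.exists_aut_fixing hc hout hx₀ hx'
  refine (Set.eq_of_subset_of_ncard_le (layerAncestors_mono hc hxy) ?_ (hfin y)).symm
  calc (D.layerAncestors u k y).ncard ≤ sSup C := le_csSup hbdd ⟨_, y, hxy', rfl⟩
    _ = (D.layerAncestors u k (g x₀)).ncard := by
        rw [layerAncestors_map g hgu, Set.ncard_image_of_injective _ g.injective, hmax]
    _ ≤ _ := Set.ncard_le_ncard (layerAncestors_mono hc hx'x) (hfin x)

/-! ### Swapping components of a descendant set -/

/-- Two vertices lie in the same weak component of the subdigraph induced on `desc X`. -/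
def Linked (D : Digraph V) (X : Set V) : V → V → Prop :=
  EqvGen fun a b => a ∈ D.desc X ∧ b ∈ D.desc X ∧ D.Adj a b

theorem mem_desc_map (g : D.Aut) (hg : ∀ x ∈ X, g x ∈ X) (hz : z ∈ D.desc X) :
    g z ∈ D.desc X := by
  obtain ⟨x, hx, s, hs⟩ := hz
  exact ⟨g x, hg x hx, s, HasArc.map hs g⟩

theorem Linked.map (g : D.Aut) (hg : ∀ x ∈ X, g x ∈ X) (h : D.Linked X x y) :
    D.Linked X (g x) (g y) := by
  induction h with
  | rel a b h =>
    exact .rel _ _ ⟨mem_desc_map g hg h.1, mem_desc_map g hg h.2.1, g.map_rel_iff.2 h.2.2⟩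
  | refl a => exact .refl _
  | symm a b _ ih => exact .symm _ _ ih
  | trans a b c _ _ h₁ h₂ => exact .trans _ _ _ h₁ h₂

/-- If an automorphism preserving `X` moves `x` to `y`, where `x` and `y` lie in distinct components
of `desc X`, then some automorphism preserving `X` moves `x` to `y` and fixes all elements of `X`
in other components. -/
theorem WeaklyDescendantHomogeneous.exists_swap (hhom : D.WeaklyDescendantHomogeneous)
    (hc : D.NoDirectedCycles) (hX : X.Finite) (g : D.Aut) (hg : ∀ x ∈ X, g x ∈ X)
    (hg' : ∀ x ∈ X, g.symm x ∈ X) (hx : x ∈ X) (hxy : g x = y) (hl : ¬ D.Linked X x y) :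
    ∃ h : D.Aut, (∀ z ∈ X, h z ∈ X) ∧ h x = y ∧
      ∀ z ∈ X, ¬ D.Linked X x z → ¬ D.Linked X y z → h z = z := by
  classical
  subst hxy
  -- Using `g.symm` on the second component makes `f` an involution, so preserving edges is enough
  -- for an isomorphism.
  let f : V → V := fun z =>
    if D.Linked X x z then g z else if D.Linked X (g x) z then g.symm z else z
  have f₁ : ∀ {z}, D.Linked X x z → f z = g z := fun h => if_pos h
  have f₂ : ∀ {z}, D.Linked X (g x) z → f z = g.symm z := fun {z} h => by
    have : ¬ D.Linked X x z := fun h' => hl (h'.trans _ _ _ (h.symm _ _))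
    simp only [f, if_neg this, if_pos h]
  have f₃ : ∀ {z}, ¬ D.Linked X x z → ¬ D.Linked X (g x) z → f z = z := fun h h' => by
    simp only [f, if_neg h, if_neg h']
  have hinv : Function.Involutive f := by
    intro z
    by_cases h₁ : D.Linked X x z
    · rw [f₁ h₁, f₂ (h₁.map g hg)]; simp
    by_cases h₂ : D.Linked X (g x) z
    · have h₃ : D.Linked X x (g.symm z) := by simpa using h₂.map g.symm hg'
      rw [f₂ h₂, f₁ h₃]; simp
    · rw [f₃ h₁ h₂, f₃ h₁ h₂]
  have fX : ∀ z ∈ X, f z ∈ X := by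
    intro z hz
    by_cases h₁ : D.Linked X x z
    · rw [f₁ h₁]; exact hg z hz
    by_cases h₂ : D.Linked X (g x) z
    · rw [f₂ h₂]; exact hg' z hz
    · rwa [f₃ h₁ h₂]
  have fdesc : ∀ z ∈ D.desc X, f z ∈ D.desc X := by
    intro z hz
    by_cases h₁ : D.Linked X x z
    · rw [f₁ h₁]; exact mem_desc_map g hg hz
    by_cases h₂ : D.Linked X (g x) z
    · rw [f₂ h₂]; exact mem_desc_map g.symm hg' hz
    · rwa [f₃ h₁ h₂]
  have fadj : ∀ a ∈ D.desc X, ∀ b ∈ D.desc X, D.Adj a b → D.Adj (f a) (f b) := by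
    intro a ha b hb hab
    have hlab : D.Linked X a b := .rel _ _ ⟨ha, hb, hab⟩
    by_cases h₁ : D.Linked X x a
    · rw [f₁ h₁, f₁ (h₁.trans _ _ _ hlab)]; exact g.map_rel_iff.2 hab
    by_cases h₂ : D.Linked X (g x) a
    · rw [f₂ h₂, f₂ (h₂.trans _ _ _ hlab)]; exact g.symm.map_rel_iff.2 hab
    · rwa [f₃ h₁ h₂, f₃ (fun h => h₁ (h.trans _ _ _ (hlab.symm _ _)))
        (fun h => h₂ (h.trans _ _ _ (hlab.symm _ _)))]
  let F : (D.inducedOn (D.desc X)).Iso (D.inducedOn (D.desc X)) :=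
    { toFun := fun z => ⟨f z, fdesc z z.2⟩
      invFun := fun z => ⟨f z, fdesc z z.2⟩
      left_inv := fun z => Subtype.ext (hinv z)
      right_inv := fun z => Subtype.ext (hinv z)
      map_rel_iff' := by
        intro a b
        refine ⟨fun h => ?_, fun h => fadj a a.2 b b.2 h⟩
        have := fadj _ (fdesc a a.2) _ (fdesc b b.2) h
        rwa [hinv, hinv] at this }
  obtain ⟨h, hh⟩ := hhom.2 X X hX hX F
  have hdesc : ∀ z ∈ X, z ∈ D.desc X := fun z hz => ⟨z, hz, 0, (hasArc_zero hc).2 rfl⟩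
  have hf : ∀ z ∈ X, h z = f z := fun z hz => hh ⟨z, hdesc z hz⟩ hz
  refine ⟨h, fun z hz => hf z hz ▸ fX z hz, ?_, fun z hz h₁ h₂ => ?_⟩
  · rw [hf x hx, f₁ (.refl _)]
  · rw [hf z hz, f₃ h₁ h₂]

/-- The swap of two components of `desc (D^n(u))` can be chosen to fix `u` if `δ_n` is trivial. -/
theorem WeaklyDescendantHomogeneous.exists_swap_fixing (hhom : D.WeaklyDescendantHomogeneous)
    (hc : D.NoDirectedCycles) (hout : D.HasOutValency m) (hdist : D.DistanceTransitive)
    (htriv : ¬ NontrivialRel (D.delta n)) (hx : D.HasArc n u x) (hy : D.HasArc n u y)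
    (hl : ¬ D.Linked (D.descLayer n u) x y) :
    ∃ h : D.Aut, h u = u ∧ h x = y ∧ ∀ z, D.HasArc n u z →
      ¬ D.Linked (D.descLayer n u) x z → ¬ D.Linked (D.descLayer n u) y z → h z = z := by
  obtain ⟨g, hgu, hgx⟩ := hdist.exists_aut_fixing hc hout hx hy
  have hfin := hout.finite_descLayer hc n u
  obtain ⟨h, hX, hxy, hz⟩ := hhom.exists_swap hc hfin g
    (fun z hz => by simpa [hgu, descLayer] using HasArc.map hz g)
    (fun z hz => by
      have hz : D.HasArc n u z := hz
      refine (hasArc_map_iff g).1 ?_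
      simpa [hgu] using hz) hx hgx hl
  refine ⟨h, ?_, hxy, hz⟩
  -- The image of `D^n(u)` under `h` is both `D^n(h u)` and `D^n(u)`, so `h u` and `u` are
  -- `δ_n`-related.
  by_contra hne
  refine htriv ⟨h u, u, hne, ?_⟩
  rw [delta, descLayer_map]
  exact Set.eq_of_subset_of_ncard_le (Set.image_subset_iff.2 hX)
    (Set.ncard_image_of_injective _ h.injective).ge hfin

/-- If all `δ_n` are trivial, distinct components of `desc (D^n(u))` have distinct ancestors in the
first layer, as soon as these ancestors are constant on components. -/
theorem linked_of_layerAncestors_eq (hhom : D.WeaklyDescendantHomogeneous)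
    (hc : D.NoDirectedCycles) (hm : 1 < m) (hout : D.HasOutValency m)
    (hdist : D.DistanceTransitive) (htriv : ∀ n, 1 ≤ n → ¬ NontrivialRel (D.delta n))
    (hn : 2 ≤ n)
    (hstab : ∀ a b, D.Linked (D.descLayer n u) a b →
      D.layerAncestors u 1 a = D.layerAncestors u 1 b)
    (hx : D.HasArc n u x) (hy : D.HasArc n u y)
    (hxy : D.layerAncestors u 1 x = D.layerAncestors u 1 y) :
    D.Linked (D.descLayer n u) x y := by
  by_contra hl
  have hconst : ∀ z, D.HasArc n u z → D.layerAncestors u 1 z = D.layerAncestors u 1 x := by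
    intro z hz
    by_cases h₁ : D.Linked (D.descLayer n u) z x
    · exact hstab _ _ h₁
    by_cases h₂ : D.Linked (D.descLayer n u) y z
    · exact (hstab _ _ h₂).symm.trans hxy.symm
    -- Move `y` to `z` while fixing `x`: the set of `x` is unchanged, and it is also the set of `y`,
    -- which is carried to that of `z`.
    obtain ⟨h, hu, hyz, hfix⟩ :=
      hhom.exists_swap_fixing hc hout hdist (htriv n (by omega)) hy hz h₂
    have hhx : h x = x := hfix x hx (fun h => hl (h.symm _ _)) h₁
    rw [← hyz, layerAncestors_map h hu, ← hxy, ← layerAncestors_map h hu, hhx]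
  obtain ⟨n, rfl⟩ := Nat.exists_eq_add_of_le (show 1 ≤ n by omega)
  -- With a common ancestor set, each out-neighbour of `u` lies above the whole layer, so any two of
  -- them are related by `δ` with index one less than the depth of the layer.
  have hall : ∀ v, D.Adj u v → D.descLayer n v = D.descLayer (1 + n) u := by
    intro v hv
    have hv' := (hasArc_one hc).2 hv
    ext z
    refine ⟨fun hz => hv'.trans hc hz, fun hz => ?_⟩
    obtain ⟨z', hz'⟩ := hout.exists_hasArc hc (by omega) n v
    have hmem : v ∈ D.layerAncestors u 1 z' := ⟨hv', n, hz'⟩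
    rw [hconst z' (hv'.trans hc hz'), ← hconst z hz] at hmem
    exact hasArc_of_mem_layerAncestors hc hout hdist hz hmem
  have hcard : 1 < {v | D.Adj u v}.encard := by
    rw [hout u]; exact_mod_cast hm
  obtain ⟨v, w, hv, hw, hne⟩ := Set.one_lt_encard_iff.1 hcard
  exact htriv n (by omega) ⟨v, w, hne, (hall v hv).trans (hall w hw).symm⟩

/-- Both ends of an edge of `desc (D^n(u))` descend from one vertex of `D^n(u)`, whose ancestor set
they share by stability. -/
theorem layerAncestors_eq_of_linked (hc : D.NoDirectedCycles)
    (hstab : ∀ x, D.HasArc n u x → ∀ t y, D.HasArc t x y →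
      D.layerAncestors u k y = D.layerAncestors u k x) (h : D.Linked (D.descLayer n u) x y) :
    D.layerAncestors u k x = D.layerAncestors u k y := by
  induction h with
  | rel a b h =>
    obtain ⟨⟨x, hx, s, hs⟩, -, hab⟩ := h
    rw [hstab x hx s a hs, hstab x hx (s + 1) b ((hasArc_succ hc).2 ⟨a, hs, hab⟩)]
  | refl a => rfl
  | symm a b _ ih => exact ih.symm
  | trans a b c _ _ h₁ h₂ => exact h₁.trans h₂

theorem exists_nontrivialRel_delta_of_one_lt (hhom : D.WeaklyDescendantHomogeneous)
    (hc : D.NoDirectedCycles) (hm : 1 < m) (hout : D.HasOutValency m)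
    (hdist : D.DistanceTransitive) (u : V) :
    ∃ n, 1 ≤ n ∧ NontrivialRel (D.delta n) := by
  by_contra! htriv
  obtain ⟨N, hN⟩ := exists_layerAncestors_stable hc hout hdist u 1
  have hinj : ∀ n, N ≤ n → ∀ x y, D.HasArc n u x → D.HasArc n u y →
      D.layerAncestors u 1 x = D.layerAncestors u 1 y → x = y := by
    intro n hn x y hx hy hxy
    by_contra hne
    obtain ⟨K, hK⟩ := exists_layerAncestors_stable hc hout hdist u n
    have key : ∀ x y, D.HasArc n u x → D.HasArc n u y →
        D.layerAncestors u 1 x = D.layerAncestors u 1 y →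
        -- Depth `K` stabilizes ancestors in layer `n`; the extra 2 meets the lower bound `2 ≤ n` of
        -- `linked_of_layerAncestors_eq`. Descendants of `x` and `y` lie in one component, hence
        -- have the same ancestors in layer `n`, among them `y`.
        D.descLayer (K + 2) x ⊆ D.descLayer (K + 2) y := by
      intro x y hx hy hxy a ha
      have ha' := hx.trans hc ha
      obtain ⟨b, hb⟩ := hout.exists_hasArc hc (by omega) (K + 2) y
      have hb' := hy.trans hc hb
      have hab : D.Linked (D.descLayer (n + (K + 2)) u) a b :=
        linked_of_layerAncestors_eq hhom hc hm hout hdist htriv (by omega)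
          (fun c d h => layerAncestors_eq_of_linked hc (hN _ (by omega)) h) ha' hb'
          (by rw [hN n hn x hx _ a ha, hN n hn y hy _ b hb, hxy])
      have hA := layerAncestors_eq_of_linked hc (hK _ (by omega)) hab
      have hyb : y ∈ D.layerAncestors u n b := ⟨hy, _, hb⟩
      rw [← hA] at hyb
      exact hasArc_of_mem_layerAncestors hc hout hdist ha' hyb
    exact htriv (K + 2) (by omega)
      ⟨x, y, hne, (key x y hx hy hxy).antisymm (key y x hy hx hxy.symm)⟩
  -- Two out-neighbours of a vertex at depth `N` both inherit its ancestor set, contradicting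
  -- `hinj`.
  obtain ⟨x, hx⟩ := hout.exists_hasArc hc (by omega) N u
  have hcard : 1 < {v | D.Adj x v}.encard := by
    rw [hout x]; exact_mod_cast hm
  obtain ⟨v, w, hv, hw, hne⟩ := Set.one_lt_encard_iff.1 hcard
  refine hne (hinj (N + 1) (by omega) v w ((hasArc_succ hc).2 ⟨x, hx, hv⟩)
    ((hasArc_succ hc).2 ⟨x, hx, hw⟩) ?_)
  rw [hN N le_rfl x hx 1 v ((hasArc_one hc).2 hv), hN N le_rfl x hx 1 w ((hasArc_one hc).2 hw)]

/-! ### Out-valency one -/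

theorem nonempty_iso_intPath (hconn : D.toSimpleGraphInclusive.Connected)
    (hvt : D.VertexTransitive) (hc : D.NoDirectedCycles) (hout : D.HasOutValency 1)
    (htriv : ¬ NontrivialRel (D.delta 1)) : Nonempty (D.Iso intPath) := by
  have hex : ∀ u, ∃ v, {v | D.Adj u v} = {v} := fun u => by
    simpa [Set.encard_eq_one] using hout u
  choose f hf using hex
  have hadj : ∀ {u v}, D.Adj u v ↔ v = f u := fun {u v} => by
    simpa using Set.ext_iff.1 (hf u) v
  have hlayer : ∀ u, D.descLayer 1 u = {f u} := fun u => by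
    rw [← hf u]; ext v; exact hasArc_one hc
  have hinj : Function.Injective f := by
    intro a b hab
    by_contra hne
    exact htriv ⟨a, b, hne, by rw [delta, hlayer, hlayer, hab]⟩
  have hsurj : Function.Surjective f := by
    intro b
    -- `f b` has an in-neighbour, hence by transitivity so does `b`.
    obtain ⟨g, hg⟩ := hvt (f b) b
    have h : D.Adj (g b) (g (f b)) := g.map_rel_iff.2 (hadj.2 rfl)
    exact ⟨g b, by rw [← hadj.1 h, hg]⟩
  let φ : Equiv.Perm V := Equiv.ofBijective f ⟨hinj, hsurj⟩
  have hφ : ∀ {u v}, D.Adj u v ↔ v = φ u := hadj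
  obtain ⟨u⟩ := hconn.nonempty
  have hsucc : ∀ i : ℤ, (φ ^ (i + 1)) u = φ ((φ ^ i) u) := fun i => by
    rw [add_comm, zpow_add, zpow_one, Equiv.Perm.mul_apply]
  have hreach : ∀ v : V, ∀ n : ℕ, D.Steps n v ((φ ^ n) v) := by
    intro v n
    induction n with
    | zero => rfl
    | succ n ih => exact ⟨_, ih, hφ.2 (by rw [pow_succ', Equiv.Perm.mul_apply])⟩
  have hne : ∀ i j : ℤ, i < j → (φ ^ i) u ≠ (φ ^ j) u := by
    intro i j hij heq
    obtain ⟨n, hn⟩ := Int.eq_ofNat_of_zero_le (sub_nonneg.2 hij.le)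
    refine hc ((φ ^ i) u) ?_
    have h := (hreach ((φ ^ i) u) n).transGen (by omega)
    rwa [← Equiv.Perm.mul_apply, ← zpow_natCast, ← zpow_add, ← hn, sub_add_cancel, ← heq] at h
  have hzinj : Function.Injective fun i : ℤ => (φ ^ i) u := by
    intro i j hij
    rcases lt_trichotomy i j with h | h | h
    · exact absurd hij (hne i j h)
    · exact h
    · exact absurd hij.symm (hne j i h)
  have hzsurj : Function.Surjective fun i : ℤ => (φ ^ i) u := by
    intro v
    obtain ⟨p⟩ := hconn.preconnected u v
    suffices h : ∀ a b, D.toSimpleGraphInclusive.Walk a b → (∃ i : ℤ, (φ ^ i) u = a) →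
        ∃ i : ℤ, (φ ^ i) u = b from h u v p ⟨0, by simp⟩
    intro a b p
    induction p with
    | nil => exact id
    | cons h p ih =>
      rintro ⟨i, rfl⟩
      refine ih ?_
      rcases (SimpleGraph.fromRel_adj _ _ _).1 h with ⟨-, h | h⟩
      · exact ⟨i + 1, by rw [hsucc, hφ.1 h]⟩
      · refine ⟨i - 1, φ.injective ?_⟩
        rw [← hsucc, sub_add_cancel, hφ.1 h]
  let e : ℤ ≃ V := Equiv.ofBijective _ ⟨hzinj, hzsurj⟩
  refine ⟨(RelIso.mk e ?_ : intPath.Adj ≃r D.Adj).symm⟩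
  intro i j
  change D.Adj ((φ ^ i) u) ((φ ^ j) u) ↔ j = i + 1
  rw [hφ, ← hsucc]
  exact hzinj.eq_iff

/-! ### Blocks -/

theorem imprimitive_of_nontrivialRel_delta (hc : D.NoDirectedCycles) (hm : 0 < m)
    (hout : D.HasOutValency m) (hn : 1 ≤ n) (h : NontrivialRel (D.delta n)) :
    D.Imprimitive := by
  obtain ⟨u, v, hne, huv⟩ := h
  refine ⟨{w | D.delta n u w}, ?_, ⟨u, rfl, v, huv, hne⟩, fun huniv => ?_⟩
  · rw [MulAction.isBlock_iff_smul_eq_of_nonempty]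
    rintro g ⟨_, ⟨b, hb, rfl⟩, hgb⟩
    have hb : D.descLayer n u = D.descLayer n b := hb
    have hgb : D.descLayer n u = D.descLayer n (g b) := hgb
    rw [descLayer_map, ← hb] at hgb
    ext w
    constructor
    · rintro ⟨c, hcc, rfl⟩
      have hcc : D.descLayer n u = D.descLayer n c := hcc
      change D.descLayer n u = D.descLayer n (g c)
      rw [descLayer_map, ← hcc, ← hgb]
    · intro hw
      have hw : D.descLayer n u = D.descLayer n w := hw
      refine ⟨g.symm w, ?_, g.apply_symm_apply w⟩
      change D.descLayer n u = D.descLayer n (g.symm w)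
      rw [← (Set.image_injective.2 g.injective).eq_iff, ← hgb, ← descLayer_map,
        g.apply_symm_apply, hw]
  -- The class is proper: `w ∈ D^n(u)` related to `u` would lie in its own layer, giving a cycle.
  · obtain ⟨w, hw⟩ := hout.exists_hasArc hc hm n u
    have huw : D.descLayer n u = D.descLayer n w :=
      Set.eq_univ_iff_forall.1 huniv w
    have hww : w ∈ D.descLayer n w := huw ▸ hw
    exact hc w (HasArc.steps hww |>.transGen hn)

/-- Automorphisms of `Z` are translations, which preserve or exchange the parity classes. -/
theorem imprimitive_of_iso_intPath (e : D.Iso intPath) : D.Imprimitive := by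
  have htrans : ∀ g : D.Aut, ∀ i : ℤ, e (g (e.symm i)) = e (g (e.symm 0)) + i := by
    intro g
    have hstep : ∀ i : ℤ, e (g (e.symm (i + 1))) = e (g (e.symm i)) + 1 := fun i =>
      e.map_rel_iff.2 (g.map_rel_iff.2 (e.symm.map_rel_iff.2 (show intPath.Adj i (i + 1) from rfl)))
    intro i
    induction i using Int.induction_on with
    | zero => simp
    | succ i ih => rw [hstep, ih, add_assoc]
    | pred i ih =>
      have := hstep (-i - 1)
      rw [sub_add_cancel] at this
      omega
  have hmap : ∀ (g : D.Aut) (v : V), e (g v) = e (g (e.symm 0)) + e v := fun g v => by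
    simpa using htrans g (e v)
  refine ⟨{v | Even (e v)}, ?_, ⟨e.symm 0, by simp, e.symm 2, by simp, by simp⟩, fun h => ?_⟩
  · rw [MulAction.isBlock_iff_smul_eq_of_nonempty]
    rintro g ⟨_, ⟨b, hb, rfl⟩, hgb⟩
    have hb : Even (e b) := hb
    have hgb : Even (e (g b)) := hgb
    rw [hmap, Int.even_add] at hgb
    have h0 := hgb.2 hb
    have hev : ∀ v, Even (e (g v)) ↔ Even (e v) := fun v => by
      rw [hmap, Int.even_add]; tauto
    ext w
    constructor
    · rintro ⟨c, hcc, rfl⟩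
      exact (hev c).2 hcc
    · intro hw
      refine ⟨g.symm w, (hev _).1 ?_, g.apply_symm_apply w⟩
      rw [g.apply_symm_apply]
      exact hw
  · have := Set.eq_univ_iff_forall.1 h (e.symm 1)
    simp at this

end Digraph

theorem theorem4 {V : Type*} [Infinite V] (D : Digraph V)
    (hconn : D.toSimpleGraphInclusive.Connected)
    (hdist : D.DistanceTransitive)
    (hhom : D.WeaklyDescendantHomogeneous)
    (m : ℕ) (hm : 0 < m) (hout : D.HasOutValency m)
    (hcyc : D.NoDirectedCycles) :
    (¬ Nonempty (D.Iso Digraph.intPath) →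
      ∃ n : ℕ, 1 ≤ n ∧ Digraph.NontrivialRel (D.delta n)) ∧
    D.Imprimitive := by
  have key : ¬ Nonempty (D.Iso Digraph.intPath) →
      ∃ n : ℕ, 1 ≤ n ∧ Digraph.NontrivialRel (D.delta n) := by
    intro hiso
    rcases Nat.lt_or_ge 1 m with h | h
    · obtain ⟨u⟩ := hconn.nonempty
      exact Digraph.exists_nontrivialRel_delta_of_one_lt hhom hcyc h hout hdist u
    · obtain rfl : m = 1 := by omega
      by_contra! htriv
      exact hiso (Digraph.nonempty_iso_intPath hconn hhom.1 hcyc hout (htriv 1 le_rfl))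
  refine ⟨key, ?_⟩
  by_cases hiso : Nonempty (D.Iso Digraph.intPath)
  · exact Digraph.imprimitive_of_iso_intPath hiso.some
  · obtain ⟨n, hn, h⟩ := key hiso
    exact Digraph.imprimitive_of_nontrivialRel_delta hcyc hm hout hn h
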